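/- Let $n\ge 1$, let $\mu=(\mu_1\ge\cdots\ge\mu_n\ge 0)$ be a partition of length $\ell(\mu)\le n$, and let $x=(x_1,\dots,x_n)$ and $a=(a_1,a_2,\dots)$ be parameters in a field, the $a_j$ being non-zero for $1\le j\le \mu_1+n$. Put $\delta=(n,n-1,\dots,1)$, $\rho=(n-1,n-2,\dots,0)$, $\lambda=\mu+\delta$, $\kappa=\mu+\rho$, $m=\lambda_1=\mu_1+n$; let $\kappa'$ be the partition conjugate to $\kappa$, $|\kappa|=\sum_i\kappa_i$, and write $z^{\nu}=z_1^{\nu_1}z_2^{\nu_2}\cdots$. The factorial Schur function is $$s_\mu(x\,|\,a)=\sum_{T}\ \prod_{(i,j)}\bigl(x_{T_{ij}}+a_{T_{ij}+j-i}\bigr),$$ where $T$ runs over the semistandard tableaux of shape $\mu$ with entries in $\{1,\dots,n\}$ (weakly increasing along rows, strictly increasing down columns) and $(i,j)$ over the boxes of the Young diagram of $\mu$ (row $i$, column $j$). Consider the $n\times m$ square grid of vertices, with rows numbered $1,\dots,n$ from top to bottom and columns $1,\dots,m$ from left to right. An admissible configuration is an orientation of all its edges, including the boundary edges, such that every vertex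 has exactly two incoming and two outgoing edges, all horizontal boundary edges are incoming, all vertical boundary edges on the top are outgoing, and the vertical boundary edge at the bottom of column $j$ is outgoing if $j\in\{\lambda_1,\dots,\lambda_n\}$ and incoming otherwise. A vertex is of type $\mathrm{XY}\in\{\mathrm{WE},\mathrm{NS},\mathrm{NE},\mathrm{SE},\mathrm{NW},\mathrm{SW}\}$ if its two incoming edges come from the directions $\mathrm X$ and $\mathrm Y$. Let $Z(\mathfrak S_\mu)$ be the partition function of this six-vertex model, that is, the sum over all admissible configurations of the product over all vertices $(i,j)$ of the Boltzmann weights given by $$\begin{array}{c|cccccc}\text{type}&\mathrm{WE}&\mathrm{NS}&\mathrm{NE}&\mathrm{SE}&\mathrm{NW}&\mathrm{SW}\\ \hline \text{weight at }(i,j)&1&-x_i/a_j&1&1&1&-(x_i/a_j+1)\end{array}$$ Then $$Z(\mathfrak S_\mu)=\frac{x^{\rho}}{a^{\kappa'}}\,(-1)^{|\kappa|}\,s_\mu(x\,|\,a).$$ -/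

import Mathlib

namespace SixVertex

/-! ### Partitions, written as sequences `ν 1, ν 2, …, ν n` -/

/-- `λ = μ + δ` with `δ = (n, n-1, …, 1)`: `λ_i = μ_i + n + 1 - i` for `1 ≤ i ≤ n`
(the rows of a `YoungDiagram` are numbered from `0` on, so `μ_i = μ.rowLen (i - 1)`). -/
def lam (n : ℕ) (μ : YoungDiagram) (i : ℕ) : ℕ := μ.rowLen (i - 1) + (n + 1 - i)

/-- `ρ = (n-1, n-2, …, 0)`. -/
def rho (n : ℕ) (i : ℕ) : ℕ := n - i

/-- `κ = μ + ρ`. -/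
def kap (n : ℕ) (μ : YoungDiagram) (i : ℕ) : ℕ := μ.rowLen (i - 1) + rho n i

/-- The weight `|ν| = ν_1 + ⋯ + ν_n`. -/
def weight (n : ℕ) (ν : ℕ → ℕ) : ℕ := ∑ i ∈ Finset.Icc 1 n, ν i

/-- The `j`-th part (`j ≥ 1`) of the partition conjugate to `(ν_1, …, ν_n)`: the number of parts
`ν_i ≥ j`. -/
def conj (n : ℕ) (ν : ℕ → ℕ) (j : ℕ) : ℕ := ((Finset.Icc 1 n).filter (fun i => j ≤ ν i)).card

/-- `z^ν = z_1^{ν_1} ⋯ z_r^{ν_r}`. -/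
def multiPow {K : Type*} [Field K] (r : ℕ) (z : ℕ → K) (ν : ℕ → ℕ) : K :=
  ∏ i ∈ Finset.Icc 1 r, z i ^ ν i

/-! ### Factorial Schur functions -/

/-- The semistandard tableaux of shape `μ` with entries in `{1, …, n}`. -/
def boundedSSYT (n : ℕ) (μ : YoungDiagram) : Set (SemistandardYoungTableau μ) :=
  {T | ∀ c ∈ μ.cells, 1 ≤ T c.1 c.2 ∧ T c.1 c.2 ≤ n}

theorem boundedSSYT_finite (n : ℕ) (μ : YoungDiagram) : (boundedSSYT n μ).Finite := by
  let f : SemistandardYoungTableau μ → (μ.cells → ℕ) := fun T c => T c.1.1 c.1.2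
  refine Set.Finite.of_finite_image (f := f) ?_ ?_
  · refine (Set.Finite.pi' (t := fun _ : μ.cells => Set.Iic n)
      (fun _ => Set.finite_Iic n)).subset ?_
    rintro _ ⟨T, hT, rfl⟩ c
    exact (hT c.1 c.2).2
  · intro T _ T' _ h
    ext i j
    by_cases hc : (i, j) ∈ μ
    · exact congrFun h ⟨(i, j), (YoungDiagram.mem_cells _).2 hc⟩
    · rw [T.zeros hc, T'.zeros hc]

/-- The factorial Schur function
`s_μ(x | a) = ∑_T ∏_{(i,j) ∈ F^μ} (x_{T_ij} + a_{T_ij + j - i})`, the sum being over the semistandard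
tableaux `T` of shape `μ` with entries in `{1, …, n}`. The difference `j - i` does not depend on
whether rows and columns are numbered from `0` or from `1`, and the subtraction does not truncate,
because `T_ij ≥ i` in a semistandard tableau with positive entries. -/
noncomputable def factorialSchur {K : Type*} [Field K] (n : ℕ) (μ : YoungDiagram)
    (x a : ℕ → K) : K :=
  ∑ T ∈ (boundedSSYT_finite n μ).toFinset,
    ∏ c ∈ μ.cells, (x (T c.1 c.2) + a (T c.1 c.2 + c.2 - c.1))

/-! ### The six-vertex model -/

/-- The six types of vertices, named by the two directions from which the incoming edges come. -/
inductive Compass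
  | WE | NS | NE | SE | NW | SW

/-- An orientation of all edges of the grid with `n` rows and `m` columns of vertices, including the
boundary edges. The vertex in row `i`, column `j` (numbered from `0`, from top to bottom and from
left to right) has the horizontal edge `hor i j` to its west and `hor i (j + 1)` to its east, the
vertical edge `ver i j` to its north and `ver (i + 1) j` to its south. -/
structure Orientation (n m : ℕ) where
  /-- `true` if the horizontal edge points east, `false` if it points west. -/
  hor : Fin n → Fin (m + 1) → Bool
  /-- `true` if the vertical edge points south, `false` if it points north. -/
  ver : Fin (n + 1) → Fin m → Bool

/-- Orientations as pairs of functions. -/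
def Orientation.equivProd (n m : ℕ) :
    Orientation n m ≃ (Fin n → Fin (m + 1) → Bool) × (Fin (n + 1) → Fin m → Bool) where
  toFun s := (s.hor, s.ver)
  invFun p := ⟨p.1, p.2⟩
  left_inv _ := rfl
  right_inv _ := rfl

instance (n m : ℕ) : Fintype (Orientation n m) := Fintype.ofEquiv _ (Orientation.equivProd n m).symm

namespace Orientation

variable {n m : ℕ}

/-- The edge to the north of the vertex `(i, j)` is incoming. -/
def inN (s : Orientation n m) (i : Fin n) (j : Fin m) : Bool := s.ver i.castSucc j

/-- The edge to the east of the vertex `(i, j)` is incoming. -/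
def inE (s : Orientation n m) (i : Fin n) (j : Fin m) : Bool := !s.hor i j.succ

/-- The edge to the south of the vertex `(i, j)` is incoming. -/
def inS (s : Orientation n m) (i : Fin n) (j : Fin m) : Bool := !s.ver i.succ j

/-- The edge to the west of the vertex `(i, j)` is incoming. -/
def inW (s : Orientation n m) (i : Fin n) (j : Fin m) : Bool := s.hor i j.castSucc

end Orientation

/-- The type of a vertex, given which of its edges (north, east, south, west) are incoming; `none` if
the number of incoming edges is not two. -/
def vertexType : (north east south west : Bool) → Option Compass
  | false, true, false, true => some Compass.WE
  | true, false, true, false => some Compass.NS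
  | true, true, false, false => some Compass.NE
  | false, true, true, false => some Compass.SE
  | true, false, false, true => some Compass.NW
  | false, false, true, true => some Compass.SW
  | _, _, _, _ => none

/-- The admissible square ice configurations with `n` rows and `m` columns for the sequence
`ν_1, …, ν_n`. -/
structure IsIce {n m : ℕ} (ν : ℕ → ℕ) (s : Orientation n m) : Prop where
  /-- Every vertex has two incoming and two outgoing edges. -/
  ice : ∀ i j, (s.inN i j).toNat + (s.inE i j).toNat + (s.inS i j).toNat + (s.inW i j).toNat = 2
  /-- The edges of the left boundary are incoming, that is, they point east. -/
  left : ∀ i, s.hor i 0 = true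
  /-- The edges of the right boundary are incoming, that is, they point west. -/
  right : ∀ i, s.hor i (Fin.last m) = false
  /-- The edges of the upper boundary are outgoing, that is, they point north. -/
  top : ∀ j, s.ver 0 j = false
  /-- The edge of the lower boundary in column `j` is outgoing (points south) if `j` is one of
  `ν_1, …, ν_n`, and is incoming otherwise. -/
  bottom : ∀ j : Fin m, s.ver (Fin.last n) j = true ↔ ∃ k ∈ Finset.Icc 1 n, ν k = (j : ℕ) + 1

open Classical in
/-- The partition function of the six-vertex model on the grid with `n` rows and `m = ν_1` columns,
with the boundary conditions given by `ν_1, …, ν_n`, in which a vertex of type `XY` in row `i` and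
column `j` (numbered from `1`) has the Boltzmann weight `β i j XY`. -/
noncomputable def partitionFunction {K : Type*} [Field K] (n : ℕ) (ν : ℕ → ℕ)
    (β : ℕ → ℕ → Compass → K) : K :=
  ∑ s : Orientation n (ν 1) with IsIce ν s, ∏ i : Fin n, ∏ j : Fin (ν 1),
    (vertexType (s.inN i j) (s.inE i j) (s.inS i j) (s.inW i j)).elim 0
      (β ((i : ℕ) + 1) ((j : ℕ) + 1))

/-- The Boltzmann weights `1, -x_i/a_j, 1, 1, 1, -(x_i/a_j + 1)` of a vertex in row `i` and column
`j`, according to its type `WE`, `NS`, `NE`, `SE`, `NW`, `SW`. -/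
def boltzmann {K : Type*} [Field K] (x a : ℕ → K) (i j : ℕ) : Compass → K
  | Compass.WE => 1
  | Compass.NS => -(x i / a j)
  | Compass.NE => 1
  | Compass.SE => 1
  | Compass.NW => 1
  | Compass.SW => -(x i / a j + 1)

end SixVertex

/-! Number columns from 0 and encode the southward edges at one level by the ordered wedge product
of the polynomials g_j = ∏_{t ≤ j} -(X/a_t + 1) (`icePoly`) in the exterior algebra of K[X]. In this
encoding a row with parameter x becomes a natural operator (`rowSum_boltzmann`): the wedge of the
bottom edges is contracted with evaluation at x, and p ↦ X (p - p(x)) / (X - x) is then applied to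
every remaining factor. Contraction removes one factor because each row has one more southward edge
below it than above it.

Iterated contraction is Laplace expansion along the first column of a determinant of divided
differences with nodes x_n, …, x_1, and the factors X come out as x^ρ (`iceForm_map_contractLeft`).
Column λ_i has index κ_i, so Z is x^ρ times the determinant of divided differences of the g_{κ_i},
in increasing order of κ_i. Since g_k is (-1)^k / (a_1 ⋯ a_k) times (X + a_1) ⋯ (X + a_k), the
scalars multiply to (-1)^|κ| / a^κ'.

The remaining determinant is s_μ(x | a), by induction on n (`factorialSchur_eq_newtonDet`): removing
the node x_n by row reduction matches removing the horizontal strip of entries n from a tableau.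
Divided differences replace the usual ratio of alternants, so the x_i need not be distinct. -/

open Finset

namespace SixVertex

/-! ### Row-by-row evaluation of the partition function -/

section Ice

variable {K : Type*} [Field K]

/-- The weight of a vertex with given incoming edges; it vanishes when the ice rule fails. -/
def vertexWeight (β : Compass → K) (north east south west : Bool) : K :=
  (vertexType north east south west).elim 0 β

/-- The total weight of a single row of vertices between the vertical edges `top` and `bot`, with
both horizontal boundary edges incoming. -/
def rowWeight {m : ℕ} (β : ℕ → Compass → K) (top bot : Fin m → Bool) : K :=
  ∑ hor : Fin (m + 1) → Bool, if hor 0 = true ∧ hor (Fin.last m) = false then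
    ∏ j : Fin m, vertexWeight (β (j + 1)) (top j) (!hor j.succ) (!bot j) (hor j.castSucc) else 0

/-- The partition function with prescribed bottom edges, defined by adding one row at a time. -/
def iceSum {m : ℕ} (β : ℕ → ℕ → Compass → K) : ℕ → (Fin m → Bool) → K
  | 0, bot => if bot = fun _ => false then 1 else 0
  | n + 1, bot => ∑ top, iceSum β n top * rowWeight (β (n + 1)) top bot

theorem iceSum_eq_sum_ver {m : ℕ} (β : ℕ → ℕ → Compass → K) (n : ℕ) (bot : Fin m → Bool) :
    iceSum β n bot = ∑ ver : Fin (n + 1) → Fin m → Bool,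
      if (ver 0 = fun _ => false) ∧ ver (Fin.last n) = bot then
        ∏ i : Fin n, rowWeight (β (i + 1)) (ver i.castSucc) (ver i.succ) else 0 := by
  induction n generalizing bot with
  | zero =>
    rw [← (Equiv.funUnique (Fin 1) (Fin m → Bool)).symm.sum_comp]
    rw [Finset.sum_eq_single bot]
    · simp [iceSum]
    · intro b _ hb
      simp [hb]
    · simp
  | succ n ih =>
    rw [iceSum]
    symm
    rw [← (Fin.snocEquiv fun _ : Fin (n + 2) => Fin m → Bool).sum_comp,
      Fintype.sum_prod_type, Finset.sum_eq_single bot]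
    · simp only [ih, Finset.sum_mul]
      rw [Finset.sum_comm]
      refine Finset.sum_congr rfl fun ver _ => ?_
      symm
      rw [Finset.sum_eq_single (ver (Fin.last n))]
      · have h0 : (Fin.snoc ver bot : Fin (n + 2) → Fin m → Bool) 0 = ver 0 := by
          rw [← Fin.castSucc_zero, Fin.snoc_castSucc]
        have h1 : (Fin.snoc ver bot : Fin (n + 2) → Fin m → Bool) (Fin.last n).succ = bot := by
          rw [Fin.succ_last, Fin.snoc_last]
        simp [Fin.snocEquiv, Fin.prod_univ_castSucc (n := n), h0, h1,
          ← Fin.castSucc_succ, -Fin.succ_last]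
      · intro b _ hb
        rw [if_neg (fun h => hb h.2.symm), zero_mul]
      · simp
    · intro b _ hb
      refine Finset.sum_eq_zero fun ver _ => if_neg fun h => hb ?_
      simpa [Fin.snocEquiv] using h.2
    · simp

theorem vertexType_eq_none {b₁ b₂ b₃ b₄ : Bool}
    (h : b₁.toNat + b₂.toNat + b₃.toNat + b₄.toNat ≠ 2) : vertexType b₁ b₂ b₃ b₄ = none := by
  revert h
  cases b₁ <;> cases b₂ <;> cases b₃ <;> cases b₄ <;> simp [vertexType]

/-- Orientations violating the ice rule have a vertex of weight zero, so only the boundary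
conditions restrict the sum. For fixed vertical edges the rows are then independent, and the sum
over horizontal edges factors by distributivity. -/
theorem partitionFunction_eq_iceSum (n : ℕ) (ν : ℕ → ℕ) (β : ℕ → ℕ → Compass → K)
    (bot : Fin (ν 1) → Bool)
    (hbot : ∀ j, bot j = true ↔ ∃ k ∈ Finset.Icc 1 n, ν k = (j : ℕ) + 1) :
    partitionFunction n ν β = iceSum β n bot := by
  rw [iceSum_eq_sum_ver, partitionFunction, Finset.sum_filter,
    ← Equiv.sum_comp (Orientation.equivProd n (ν 1)).symm, Fintype.sum_prod_type_right]
  refine Finset.sum_congr rfl fun ver _ => ?_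
  simp only [rowWeight]
  by_cases hv : (ver 0 = fun _ => false) ∧ ver (Fin.last n) = bot
  · rw [if_pos hv, Finset.prod_univ_sum, Fintype.piFinset_univ]
    refine Finset.sum_congr rfl fun hor _ => ?_
    rw [Finset.prod_ite_zero]
    by_cases hb : ∀ i ∈ (Finset.univ : Finset (Fin n)),
        hor i 0 = true ∧ hor i (Fin.last (ν 1)) = false
    · rw [if_pos hb]
      split_ifs with hI
      · rfl
      · have : ¬ ∀ i j, (((Orientation.equivProd n (ν 1)).symm (hor, ver)).inN i j).toNat +
            (((Orientation.equivProd n (ν 1)).symm (hor, ver)).inE i j).toNat +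
            (((Orientation.equivProd n (ν 1)).symm (hor, ver)).inS i j).toNat +
            (((Orientation.equivProd n (ν 1)).symm (hor, ver)).inW i j).toNat = 2 := by
          intro h
          refine hI ⟨h, fun i => (hb i (mem_univ i)).1, fun i => (hb i (mem_univ i)).2,
            fun j => congrFun hv.1 j, fun j => ?_⟩
          have := congrFun hv.2 j
          change ver (Fin.last n) j = true ↔ _
          rw [this, hbot]
        push Not at this
        obtain ⟨i, j, hij⟩ := this
        symm
        refine Finset.prod_eq_zero (mem_univ i) (Finset.prod_eq_zero (mem_univ j) ?_)
        have h := vertexType_eq_none hij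
        simp only [Orientation.inN, Orientation.inE, Orientation.inS, Orientation.inW,
          Orientation.equivProd, Equiv.coe_fn_symm_mk] at h
        rw [vertexWeight, h]
        rfl
    · rw [if_neg hb, if_neg]
      intro hI
      exact hb fun i _ => ⟨hI.left i, hI.right i⟩
  · rw [if_neg hv]
    refine Finset.sum_eq_zero fun hor _ => if_neg fun hI => hv ⟨funext hI.top, funext fun j => ?_⟩
    have := hI.bottom j
    rw [Bool.eq_iff_iff, hbot]
    exact this

end Ice

/-! ### Divided differences -/

section Newton

open Polynomial

variable {K : Type*} [Field K]

theorem X_sub_C_mul_divByMonic (x : K) (p : K[X]) :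
    (X - C x) * (p /ₘ (X - C x)) = p - C (p.eval x) := by
  rw [X_sub_C_mul_divByMonic_eq_sub_modByMonic, modByMonic_X_sub_C_eq_C_eval]

theorem X_sub_C_mul_divByMonic_cancel (x : K) (q : K[X]) :
    ((X - C x) * q) /ₘ (X - C x) = q :=
  mul_divByMonic_cancel_left q (monic_X_sub_C x)

/-- The linear map `p ↦ (p - p(x)) / (X - x)`. -/
noncomputable def divX (x : K) : K[X] →ₗ[K] K[X] where
  toFun p := p /ₘ (X - C x)
  map_add' p q := by
    apply mul_left_cancel₀ (X_sub_C_ne_zero x)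
    rw [mul_add]
    simp only [X_sub_C_mul_divByMonic, eval_add, C_add]
    ring
  map_smul' c p := by
    apply mul_left_cancel₀ (X_sub_C_ne_zero x)
    rw [RingHom.id_apply, smul_eq_C_mul, smul_eq_C_mul, mul_left_comm]
    simp only [X_sub_C_mul_divByMonic, eval_mul, eval_C, C_mul]
    ring

theorem X_sub_C_mul_divX (x : K) (p : K[X]) : (X - C x) * divX x p = p - C (p.eval x) :=
  X_sub_C_mul_divByMonic x p

theorem divX_X_sub_C_mul (x : K) (q : K[X]) : divX x ((X - C x) * q) = q :=
  X_sub_C_mul_divByMonic_cancel x q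

theorem divX_C (x c : K) : divX x (C c) = 0 := by
  apply mul_left_cancel₀ (X_sub_C_ne_zero x)
  simp [X_sub_C_mul_divX]

theorem divX_X_mul (x : K) (p : K[X]) : divX x (X * p) = X * divX x p + C (p.eval x) := by
  apply mul_left_cancel₀ (X_sub_C_ne_zero x)
  rw [mul_add, mul_left_comm, X_sub_C_mul_divX, X_sub_C_mul_divX, eval_mul, eval_X, C_mul]
  ring

/-- The `j`-th divided difference `p[y 0, …, y j]`. -/
noncomputable def newtonCoeff : ℕ → (ℕ → K) → K[X] →ₗ[K] K
  | 0, y => leval (y 0)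
  | j + 1, y => newtonCoeff j (fun k => y (k + 1)) ∘ₗ divX (y 0)

@[simp] theorem newtonCoeff_zero (y : ℕ → K) (p : K[X]) : newtonCoeff 0 y p = p.eval (y 0) := rfl

theorem newtonCoeff_succ (j : ℕ) (y : ℕ → K) (p : K[X]) :
    newtonCoeff (j + 1) y p = newtonCoeff j (fun k => y (k + 1)) (divX (y 0) p) := rfl

theorem newtonCoeff_succ_C (j : ℕ) (y : ℕ → K) (c : K) : newtonCoeff (j + 1) y (C c) = 0 := by
  rw [newtonCoeff_succ, divX_C, map_zero]

/-- Leibniz rule for divided differences: as X is linear, only two terms survive. -/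
theorem newtonCoeff_succ_X_mul (j : ℕ) (y : ℕ → K) (p : K[X]) :
    newtonCoeff (j + 1) y (X * p) = y (j + 1) * newtonCoeff (j + 1) y p + newtonCoeff j y p := by
  induction j generalizing y p with
  | zero => simp [newtonCoeff_succ, divX_X_mul]
  | succ j ih =>
    rw [newtonCoeff_succ, divX_X_mul, map_add, ih, newtonCoeff_succ_C, add_zero,
      ← newtonCoeff_succ, ← newtonCoeff_succ]

/-- The determinant of the divided differences of `n` polynomials. -/
noncomputable def newtonDet (n : ℕ) (y : ℕ → K) : K[X] [⋀^Fin n]→ₗ[K] K :=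
  Matrix.detRowAlternating.compLinearMap (LinearMap.pi fun j : Fin n => newtonCoeff j y)

theorem newtonDet_apply (n : ℕ) (y : ℕ → K) (p : Fin n → K[X]) :
    newtonDet n y p = (Matrix.of fun i j : Fin n => newtonCoeff j y (p i)).det := rfl

theorem newtonDet_zero (y : ℕ → K) (p : Fin 0 → K[X]) : newtonDet 0 y p = 1 := by
  rw [newtonDet_apply, Matrix.det_isEmpty]

/-- Laplace expansion along the column of values at `y 0`; the other columns are divided differences
of the quotients by X - `y 0`. -/
theorem newtonDet_succ (n : ℕ) (y : ℕ → K) (p : Fin (n + 1) → K[X]) :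
    newtonDet (n + 1) y p = ∑ i : Fin (n + 1), (-1) ^ (i : ℕ) * (p i).eval (y 0) *
      newtonDet n (fun k => y (k + 1)) (fun k => divX (y 0) (p (i.succAbove k))) := by
  rw [newtonDet_apply, Matrix.det_succ_column_zero]
  rfl

theorem newtonDet_cons_X_sub_C_mul (n : ℕ) (y : ℕ → K) (p : K[X]) (q : Fin n → K[X]) :
    newtonDet (n + 1) y (Fin.cons p fun i => (X - C (y 0)) * q i) =
      p.eval (y 0) * newtonDet n (fun k => y (k + 1)) q := by
  rw [newtonDet_succ, Fin.sum_univ_succ, Finset.sum_eq_zero]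
  · simp [divX_X_sub_C_mul]
  · simp

/-- By the Leibniz rule, multiplication by X acts on vectors of divided differences through an upper
bidiagonal matrix with the nodes on its diagonal. -/
theorem newtonDet_X_mul (n : ℕ) (y : ℕ → K) (p : Fin n → K[X]) :
    newtonDet n y (fun i => X * p i) = (∏ j : Fin n, y j) * newtonDet n y p := by
  let U : Matrix (Fin n) (Fin n) K := Matrix.of fun i j =>
    if i = j then y j else if (i : ℕ) + 1 = j then 1 else 0
  have hU : U.det = ∏ j : Fin n, y j := by
    rw [Matrix.det_of_isUpperTriangular]
    · simp [U]
    · intro i j (hij : j < i)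
      have h1 : i ≠ j := hij.ne'
      have h2 : (i : ℕ) + 1 ≠ j := by
        have : (j : ℕ) < i := hij
        omega
      simp [U, h1, h2]
  rw [← hU, mul_comm, newtonDet_apply, newtonDet_apply, ← Matrix.det_mul]
  congr 1
  ext i j
  rw [Matrix.mul_apply]
  simp only [Matrix.of_apply, U]
  obtain ⟨j, hj⟩ := j
  cases j with
  | zero =>
    rw [Finset.sum_eq_single ⟨0, hj⟩]
    · simp [mul_comm]
    · intro k _ hk
      simp [hk]
    · simp
  | succ j =>
    have hne : (⟨j, by omega⟩ : Fin n) ≠ ⟨j + 1, hj⟩ := by simp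
    rw [Finset.sum_eq_add (⟨j + 1, hj⟩ : Fin n) ⟨j, by omega⟩ hne.symm]
    · simp [newtonCoeff_succ_X_mul, mul_comm (y (j + 1))]
    · rintro k - ⟨h1, h2⟩
      have h3 : (k : ℕ) ≠ j := fun h => h2 (Fin.ext h)
      simp [h1, h3]
    · simp
    · simp

end Newton

/-! ### The row transfer matrix on the exterior algebra -/

section Transfer

variable {K M : Type*} [Field K] [AddCommGroup M] [Module K M]

/-- The ordered product of the vectors `g j` over the columns `j` with `η j = true`. -/
noncomputable def wedge (g : ℕ → M) {m : ℕ} (η : Fin m → Bool) : ExteriorAlgebra K M :=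
  (List.ofFn fun j : Fin m => if η j then ExteriorAlgebra.ι K (g j) else 1).prod

theorem wedge_zero (g : ℕ → M) (η : Fin 0 → Bool) : wedge (K := K) g η = 1 := by
  simp [wedge]

theorem wedge_succ (g : ℕ → M) {m : ℕ} (η : Fin (m + 1) → Bool) :
    wedge (K := K) g η = wedge g (fun j : Fin m => η j.castSucc) *
      if η (Fin.last m) then ExteriorAlgebra.ι K (g m) else 1 := by
  rw [wedge, List.ofFn_succ']
  simp [wedge]

theorem wedge_eq_ιMulti (g : ℕ → M) {m k : ℕ} (η : Fin m → Bool) (l : Fin k → Fin m)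
    (hl : StrictMono l) (h : ∀ j, η j = true ↔ ∃ i, l i = j) :
    wedge g η = ExteriorAlgebra.ιMulti K k fun i => g (l i) := by
  have hlist : List.ofFn l = (List.finRange m).filter η := by
    refine hl.sortedLT_ofFn.eq_of_mem_iff
      ((List.sortedLT_finRange m).pairwise.filter _).sortedLT fun j => ?_
    simp [h]
  have hprod : ∀ L : List (Fin m),
      (L.map fun j : Fin m => if η j then ExteriorAlgebra.ι K (g j) else 1).prod =
      ((L.filter η).map fun j : Fin m => ExteriorAlgebra.ι K (g j)).prod := fun L => by
    induction L with
    | nil => rfl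
    | cons j L ih =>
      by_cases hj : η j = true <;> simp [hj, ih]
  rw [wedge, List.ofFn_eq_map, hprod, ← hlist, ExteriorAlgebra.ιMulti_apply, List.map_ofFn]
  rfl

/-- The sign `(-1) ^ k` with `k` the number of columns `j` with `η j = true`. -/
def wedgeSign {m : ℕ} (η : Fin m → Bool) : K := ∏ j, if η j then -1 else 1

/-- Contraction is an antiderivation; the sign is the parity of the number of factors passed. -/
theorem contractLeft_wedge_mul (d : Module.Dual K M) (g : ℕ → M) {m : ℕ} (η : Fin m → Bool)
    (y : ExteriorAlgebra K M) :
    CliffordAlgebra.contractLeft d (wedge g η * y) =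
      CliffordAlgebra.contractLeft d (wedge g η) * y +
        wedgeSign (K := K) η • (wedge g η * CliffordAlgebra.contractLeft d y) := by
  induction m generalizing y with
  | zero => simp [wedge_zero, wedgeSign]
  | succ m ih =>
    rw [wedge_succ, wedgeSign, Fin.prod_univ_castSucc]
    cases η (Fin.last m) with
    | false => simpa [wedgeSign] using ih (fun j => η j.castSucc) y
    | true =>
      simp only [if_true]
      rw [mul_assoc, ih, ih]
      -- The exterior algebra is the Clifford algebra of the zero quadratic form.
      change _ + _ • (_ * CliffordAlgebra.contractLeft d (CliffordAlgebra.ι 0 _ * y)) =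
        (_ + _ • (_ * CliffordAlgebra.contractLeft d (CliffordAlgebra.ι 0 _))) * y + _
      rw [CliffordAlgebra.contractLeft_ι_mul, CliffordAlgebra.contractLeft_ι, wedgeSign,
        Algebra.algebraMap_eq_smul_one]
      simp only [mul_sub, add_mul, smul_sub, mul_assoc, smul_mul_assoc, mul_smul_comm,
        mul_neg, mul_one, neg_smul, ExteriorAlgebra.ι]
      abel

/-- The total weight of a row of vertices, with values in the exterior algebra: the vertical edges
on top are recorded by the products of the vectors `g j`, the left boundary edge points east, and
the right boundary edge points east if and only if `h = true`. -/
noncomputable def rowSum (β : ℕ → Compass → K) (g : ℕ → M) {m : ℕ} (h : Bool)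
    (bot : Fin m → Bool) : ExteriorAlgebra K M :=
  ∑ top : Fin m → Bool, ∑ hor : Fin (m + 1) → Bool,
    (if hor 0 = true ∧ hor (Fin.last m) = h then
      ∏ j : Fin m, vertexWeight (β (j + 1)) (top j) (!hor j.succ) (!bot j) (hor j.castSucc)
    else 0) • wedge g top

theorem rowSum_false (β : ℕ → Compass → K) (g : ℕ → M) {m : ℕ} (bot : Fin m → Bool) :
    rowSum β g false bot = ∑ top : Fin m → Bool, rowWeight β top bot • wedge g top := by
  simp only [rowSum, rowWeight, Finset.sum_smul]

theorem rowSum_zero (β : ℕ → Compass → K) (g : ℕ → M) (h : Bool) (bot : Fin 0 → Bool) :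
    rowSum β g h bot = if h then 1 else 0 := by
  rw [rowSum, Fintype.sum_unique, ← (Equiv.funUnique (Fin 1) Bool).symm.sum_comp]
  cases h <;> simp [wedge_zero]

theorem rowSum_succ (β : ℕ → Compass → K) (g : ℕ → M) {m : ℕ} (h : Bool)
    (bot : Fin (m + 1) → Bool) :
    rowSum β g h bot = ∑ b : Bool, ∑ h' : Bool,
      vertexWeight (β (m + 1)) b (!h) (!bot (Fin.last m)) h' •
        (rowSum β g h' (fun j : Fin m => bot j.castSucc) *
          if b then ExteriorAlgebra.ι K (g m) else 1) := by
  rw [rowSum, ← (Fin.snocEquiv fun _ : Fin (m + 1) => Bool).sum_comp, Fintype.sum_prod_type]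
  refine Finset.sum_congr rfl fun b _ => ?_
  simp only [rowSum, Finset.sum_mul, Finset.smul_sum]
  rw [Finset.sum_comm (s := (Finset.univ : Finset Bool))]
  refine Finset.sum_congr rfl fun top _ => ?_
  rw [← (Fin.snocEquiv fun _ : Fin (m + 2) => Bool).sum_comp, Fintype.sum_prod_type,
    Finset.sum_eq_single h]
  · rw [Finset.sum_comm]
    refine Finset.sum_congr rfl fun hor _ => ?_
    symm
    rw [Finset.sum_eq_single (hor (Fin.last m))]
    · have h0 : (Fin.snoc hor h : Fin (m + 2) → Bool) 0 = hor 0 := by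
        rw [← Fin.castSucc_zero, Fin.snoc_castSucc]
      have h1 : (Fin.snoc hor h : Fin (m + 2) → Bool) (Fin.last m).succ = h := by
        rw [Fin.succ_last, Fin.snoc_last]
      simp only [Fin.snocEquiv, Equiv.coe_fn_mk, h0, h1, Fin.snoc_last, and_true,
        Fin.prod_univ_castSucc (n := m), ← Fin.castSucc_succ, Fin.snoc_castSucc, wedge_succ,
        Fin.val_last, Fin.val_castSucc, smul_mul_assoc]
      by_cases hh : hor 0 = true
      · simp only [hh, if_true, smul_smul, mul_comm]
      · simp only [hh, if_false, Bool.false_eq_true, zero_smul, smul_zero]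
    · intro h' _ hh'
      rw [if_neg (fun H => hh' H.2.symm), zero_smul, zero_mul, smul_zero]
    · simp
  · intro b _ hb
    refine Finset.sum_eq_zero fun hor _ => ?_
    rw [if_neg, zero_smul]
    intro H
    exact hb (by simpa [Fin.snocEquiv] using H.2)
  · simp

/-- Induction over columns, with the state of the rightmost horizontal edge carried along. The case
`true` is needed only to close this induction. The recursions for `d` and `θ` are what makes both
formulas persist when a column with these Boltzmann weights is added. -/
theorem rowSum_boltzmann (x a : ℕ → K) (i : ℕ) (g : ℕ → M) (θ : M →ₗ[K] M)
    (d : Module.Dual K M) (hd₀ : d (g 0) = 1)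
    (hd : ∀ j, d (g (j + 1)) = -(x i / a (j + 1) + 1) * d (g j))
    (hθ : ∀ j, θ (g (j + 1)) = g (j + 1) + g j - (x i / a (j + 1) + 1) • θ (g j))
    {m : ℕ} (bot : Fin m → Bool) :
    rowSum (boltzmann x a i) g false bot =
        ExteriorAlgebra.map θ (CliffordAlgebra.contractLeft d (wedge g bot)) ∧
      rowSum (boltzmann x a i) g true bot =
        (wedgeSign bot * d (g m)) • ExteriorAlgebra.map θ (wedge g bot) +
          ExteriorAlgebra.map θ (CliffordAlgebra.contractLeft d (wedge g bot)) *
            ExteriorAlgebra.ι K (θ (g m) - g m) := by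
  induction m with
  | zero => simp [rowSum_zero, wedge_zero, wedgeSign, hd₀]
  | succ m ih =>
    obtain ⟨ihB, ihA⟩ := ih fun j => bot j.castSucc
    have hsq := ExteriorAlgebra.ι_sq_zero (R := K) (g m)
    have hsq' := ExteriorAlgebra.ι_sq_zero (R := K) (θ (g m))
    rw [rowSum_succ, rowSum_succ, wedge_succ, wedgeSign, Fin.prod_univ_castSucc]
    cases bot (Fin.last m) with
    | false =>
      simp only [Fintype.sum_bool, vertexWeight, vertexType, boltzmann, Option.elim_some,
        Option.elim_none, Bool.not_false, Bool.not_true, if_true, if_false, Bool.false_eq_true,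
        mul_one, zero_smul, one_smul, zero_add, add_zero, ihA, ihB, true_and]
      rw [hd, hθ]
      simp only [wedgeSign, map_add, map_sub, map_smul, mul_add, mul_sub, smul_add, smul_sub,
        mul_smul_comm]
      module
    | true =>
      have hc := contractLeft_wedge_mul d g (fun j => bot j.castSucc) (ExteriorAlgebra.ι K (g m))
      have hι : CliffordAlgebra.contractLeft d (ExteriorAlgebra.ι K (g m)) =
        algebraMap K _ (d (g m)) := CliffordAlgebra.contractLeft_ι 0 d (g m)
      rw [hι, Algebra.algebraMap_eq_smul_one, mul_smul_comm, mul_one] at hc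
      simp only [Fintype.sum_bool, vertexWeight, vertexType, boltzmann, Option.elim_some,
        Option.elim_none, Bool.not_false, Bool.not_true, if_true, if_false, Bool.false_eq_true,
        mul_one, zero_smul, one_smul, zero_add, add_zero, ihA, ihB, hc]
      rw [hd, hθ]
      simp only [wedgeSign, map_add, map_sub, map_smul, map_mul, mul_add, add_mul, sub_mul,
        mul_sub, smul_add, mul_smul_comm, smul_mul_assoc, mul_assoc, hsq, hsq',
        ExteriorAlgebra.map_apply_ι, mul_zero, smul_zero]
      constructor
      · module
      · module

end Transfer

/-! ### Composing the rows into a determinant of divided differences -/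

section Evaluation

open Polynomial

variable {K M : Type*} [Field K] [AddCommGroup M] [Module K M]

theorem contractLeft_ιMulti_succ (d : Module.Dual K M) (n : ℕ) (v : Fin (n + 1) → M) :
    CliffordAlgebra.contractLeft d (ExteriorAlgebra.ιMulti K (n + 1) v) =
      ∑ i : Fin (n + 1), ((-1) ^ (i : ℕ) * d (v i)) •
        ExteriorAlgebra.ιMulti K n fun k => v (i.succAbove k) := by
  induction n with
  | zero =>
    rw [ExteriorAlgebra.ιMulti_succ_apply]
    simp [ExteriorAlgebra.ι, Algebra.algebraMap_eq_smul_one, ExteriorAlgebra.ιMulti_zero_apply]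
  | succ n ih =>
    rw [ExteriorAlgebra.ιMulti_succ_apply, ExteriorAlgebra.ι,
      CliffordAlgebra.contractLeft_ι_mul, ih, Fin.sum_univ_succ (n := n + 1), sub_eq_add_neg]
    congr 1
    · simp [Matrix.vecTail, Function.comp_def]
    · rw [Finset.mul_sum, ← Finset.sum_neg_distrib]
      refine Finset.sum_congr rfl fun i _ => ?_
      rw [ExteriorAlgebra.ιMulti_succ_apply]
      simp [Matrix.vecTail, Function.comp_def, pow_succ, ExteriorAlgebra.ι]

/-- The linear form on the exterior algebra of `K[X]` that computes the partition function. -/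
noncomputable def iceForm (x : ℕ → K) (n : ℕ) : ExteriorAlgebra K K[X] →ₗ[K] K :=
  ExteriorAlgebra.liftAlternating fun i =>
    if i = n then multiPow n x (rho n) • newtonDet i (fun k => x (n - k)) else 0

theorem iceForm_ιMulti (x : ℕ → K) (n k : ℕ) (p : Fin k → K[X]) :
    iceForm x n (ExteriorAlgebra.ιMulti K k p) =
      if k = n then multiPow n x (rho n) * newtonDet k (fun k => x (n - k)) p else 0 := by
  rw [iceForm, ExteriorAlgebra.liftAlternating_apply_ιMulti]
  split_ifs <;> simp

/-- The linear map `p ↦ X * (p - p(x)) / (X - x)`. -/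
noncomputable def mulXDivX (x : K) : K[X] →ₗ[K] K[X] := LinearMap.mulLeft K X ∘ₗ divX x

theorem prod_Icc_eq_prod_fin_rev (n : ℕ) (f : ℕ → K) :
    ∏ i ∈ Icc 1 n, f i = ∏ i : Fin n, f (n - i) := by
  have hI : Icc 1 n = Ico (0 + 1) (n + 1) := by ext; simp
  rw [Fin.prod_univ_eq_prod_range (fun j => f (n - j)) n, ← prod_range_reflect, hI,
    ← prod_Ico_add', ← range_eq_Ico]
  refine prod_congr rfl fun j hj => ?_
  rw [mem_range] at hj
  congr 1
  omega

theorem multiPow_rho_succ (n : ℕ) (x : ℕ → K) :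
    multiPow (n + 1) x (rho (n + 1)) =
      multiPow n x (rho n) * ∏ j : Fin n, x (n - j) := by
  rw [← prod_Icc_eq_prod_fin_rev, multiPow, multiPow, Finset.prod_Icc_succ_top (by omega), ← Finset.prod_mul_distrib]
  simp only [rho, Nat.sub_self, pow_zero, mul_one]
  refine Finset.prod_congr rfl fun i hi => ?_
  rw [Finset.mem_Icc] at hi
  rw [← pow_succ]
  congr 1
  omega

/-- On a wedge product the contraction is the alternating sum of Laplace expansion, as in
`newtonDet_succ`. The factors X contribute x_1 ⋯ x_n, which raises x^ρ from n to n + 1 variables. -/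
theorem iceForm_map_contractLeft (x : ℕ → K) (n : ℕ) (ω : ExteriorAlgebra K K[X]) :
    iceForm x n (ExteriorAlgebra.map (mulXDivX (x (n + 1)))
      (CliffordAlgebra.contractLeft (leval (x (n + 1))) ω)) = iceForm x (n + 1) ω := by
  suffices h : iceForm x n ∘ₗ (ExteriorAlgebra.map (mulXDivX (x (n + 1)))).toLinearMap ∘ₗ
      CliffordAlgebra.contractLeft (leval (x (n + 1))) = iceForm x (n + 1) from
    LinearMap.congr_fun h ω
  refine ExteriorAlgebra.lhom_ext fun k => AlternatingMap.ext fun p => ?_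
  simp only [LinearMap.compAlternatingMap_apply, LinearMap.comp_apply, AlgHom.toLinearMap_apply]
  rw [iceForm_ιMulti]
  cases k with
  | zero => simp [ExteriorAlgebra.ιMulti_zero_apply]
  | succ k =>
    rw [contractLeft_ιMulti_succ]
    simp only [map_sum, map_smul, ExteriorAlgebra.map_apply_ιMulti, iceForm_ιMulti,
      Nat.add_right_cancel_iff, leval_apply]
    split_ifs with hk
    · subst hk
      rw [newtonDet_succ, multiPow_rho_succ, Finset.mul_sum]
      refine Finset.sum_congr rfl fun i _ => ?_
      have := newtonDet_X_mul k (fun j => x (k - j))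
        (fun j => divX (x (k + 1)) (p (i.succAbove j)))
      simp only [mulXDivX, Function.comp_def, LinearMap.comp_apply, LinearMap.mulLeft_apply,
        Nat.add_sub_add_right, Nat.sub_zero, smul_eq_mul] at this ⊢
      rw [this]
      ring
    · simp

/-- The polynomials `∏_{t ≤ j} -(X / a_t + 1)`. -/
noncomputable def icePoly (a : ℕ → K) : ℕ → K[X]
  | 0 => 1
  | j + 1 => -(C (a (j + 1))⁻¹ * X + 1) * icePoly a j

/-- The recursion for `θ` demanded by `rowSum_boltzmann`; it becomes a polynomial identity after
multiplication by X - x. -/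
theorem mulXDivX_icePoly_succ (a : ℕ → K) (x : K) (j : ℕ) :
    mulXDivX x (icePoly a (j + 1)) = icePoly a (j + 1) + icePoly a j -
      (x / a (j + 1) + 1) • mulXDivX x (icePoly a j) := by
  have key : ∀ p : K[X], (X - C x) * mulXDivX x p = X * (p - C (p.eval x)) := fun p => by
    rw [mulXDivX, LinearMap.comp_apply, LinearMap.mulLeft_apply, mul_left_comm, X_sub_C_mul_divX]
  apply mul_left_cancel₀ (X_sub_C_ne_zero x)
  rw [mul_sub, mul_smul_comm, key, key, smul_eq_C_mul]
  simp only [icePoly, eval_mul, eval_neg, eval_add, eval_C, eval_X, eval_one, C_mul, C_add, C_neg,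
    C_1, div_eq_mul_inv]
  ring

theorem iceSum_boltzmann (x a : ℕ → K) (n : ℕ) {m : ℕ} (bot : Fin m → Bool) :
    iceSum (boltzmann x a) n bot = iceForm x n (wedge (icePoly a) bot) := by
  induction n generalizing bot with
  | zero =>
    let s : Finset (Fin m) := {j | bot j = true}
    rw [wedge_eq_ιMulti (icePoly a) bot (s.orderEmbOfFin rfl) (s.orderEmbOfFin rfl).strictMono,
      iceForm_ιMulti, iceSum]
    · have : (bot = fun _ => false) ↔ s.card = 0 := by
        simp [s, Finset.filter_eq_empty_iff, funext_iff]
      by_cases h0 : s.card = 0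
      · rw [if_pos h0, if_pos (this.2 h0), newtonDet_apply,
          Matrix.det_eq_one_of_card_eq_zero (by simpa using h0)]
        simp [multiPow]
      · rw [if_neg h0, if_neg (fun h => h0 (this.1 h))]
    · intro j
      rw [← Set.mem_range, Finset.range_orderEmbOfFin]
      simp [s]
  | succ n ih =>
    have h := (rowSum_boltzmann x a (n + 1) (icePoly a) (mulXDivX (x (n + 1)))
      (leval (x (n + 1))) (by simp [icePoly]) (fun j => ?_)
      (fun j => mulXDivX_icePoly_succ a _ j) bot).1
    · rw [← iceForm_map_contractLeft, ← h, rowSum_false, map_sum, iceSum]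
      refine Finset.sum_congr rfl fun top _ => ?_
      rw [ih, map_smul, smul_eq_mul, mul_comm]
    · simp only [icePoly, leval_apply, eval_mul, eval_neg, eval_add, eval_C, eval_X, eval_one]
      ring

end Evaluation

/-! ### Branching of determinants of divided differences -/

section Branching

open Polynomial

variable {K : Type*} [Field K]

/-- The polynomials `(X + a_1) ⋯ (X + a_k)`. -/
noncomputable def facPow (a : ℕ → K) (k : ℕ) : K[X] := ∏ t ∈ range k, (X + C (a (t + 1)))

theorem facPow_succ (a : ℕ → K) (k : ℕ) :
    facPow a (k + 1) = (X + C (a (k + 1))) * facPow a k := by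
  rw [facPow, prod_range_succ, mul_comm, facPow]

/-- Write each new factor X + a_{r+1} as (X - x) + (x + a_{r+1}) and telescope from degree l up to
r. -/
theorem facPow_eq_sum_add (a : ℕ → K) (x : K) {l r : ℕ} (h : l ≤ r) :
    facPow a r = (X - C x) *
        (∑ t ∈ Ico l r, (∏ s ∈ Ico (t + 1) r, (x + a (s + 1))) • facPow a t) +
      (∏ s ∈ Ico l r, (x + a (s + 1))) • facPow a l := by
  induction r, h using Nat.le_induction with
  | base => simp
  | succ r h ih =>
    have h1 : ∑ t ∈ Ico l (r + 1), (∏ s ∈ Ico (t + 1) (r + 1), (x + a (s + 1))) • facPow a t =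
        (x + a (r + 1)) • (∑ t ∈ Ico l r, (∏ s ∈ Ico (t + 1) r, (x + a (s + 1))) • facPow a t) +
          facPow a r := by
      rw [sum_Ico_succ_top h, smul_sum, Ico_self, prod_empty, one_smul]
      congr 1
      refine sum_congr rfl fun t ht => ?_
      rw [prod_Ico_succ_top (mem_Ico.1 ht).2, mul_comm, mul_smul]
    rw [h1, prod_Ico_succ_top h, facPow_succ, mul_comm (∏ s ∈ Ico l r, _), mul_smul]
    have h2 : (X + C (a (r + 1))) * facPow a r =
        (X - C x) * facPow a r + (x + a (r + 1)) • facPow a r := by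
      rw [smul_eq_C_mul, C_add]
      ring
    rw [h2]
    nth_rewrite 2 [ih]
    rw [mul_add, smul_add, mul_smul_comm]
    abel

/-- Subtracting a multiple of the preceding row makes every row but the first divisible by X - `y
0`. The first column then has one non-zero entry at most, and multilinear expansion of the quotients
yields exponents `ζ` interlacing `l`. -/
theorem newtonDet_facPow_succ (a : ℕ → K) (n : ℕ) (y : ℕ → K) (l : Fin (n + 1) → ℕ)
    (hl : ∀ i : Fin n, l i.castSucc ≤ l i.succ) :
    newtonDet (n + 1) y (fun i => facPow a (l i)) =
      ∑ ζ ∈ Fintype.piFinset fun i : Fin n => Ico (l i.castSucc) (l i.succ),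
        newtonDet n (fun k => y (k + 1)) (fun i => facPow a (ζ i)) *
          ((∏ s ∈ range (l 0), (y 0 + a (s + 1))) *
            ∏ i, ∏ s ∈ Ico (ζ i + 1) (l i.succ), (y 0 + a (s + 1))) := by
  let v : Fin n → K[X] := fun i => ∑ t ∈ Ico (l i.castSucc) (l i.succ),
    (∏ s ∈ Ico (t + 1) (l i.succ), (y 0 + a (s + 1))) • facPow a t
  have h1 : newtonDet (n + 1) y (fun i => facPow a (l i)) =
      newtonDet (n + 1) y (Fin.cons (facPow a (l 0)) fun i => (X - C (y 0)) * v i) := by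
    rw [newtonDet_apply, newtonDet_apply]
    refine Matrix.det_eq_of_forall_row_eq_smul_add_pred
      (fun i => ∏ s ∈ Ico (l i.castSucc) (l i.succ), (y 0 + a (s + 1))) (fun j => rfl)
      fun i j => ?_
    simp only [Matrix.of_apply, Fin.cons_succ]
    rw [facPow_eq_sum_add a (y 0) (hl i), map_add, map_smul, smul_eq_mul]
  have h2 : newtonDet n (fun k => y (k + 1)) v =
      ∑ ζ ∈ Fintype.piFinset fun i : Fin n => Ico (l i.castSucc) (l i.succ),
        newtonDet n (fun k => y (k + 1))
          (fun i => (∏ s ∈ Ico (ζ i + 1) (l i.succ), (y 0 + a (s + 1))) • facPow a (ζ i)) :=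
    (newtonDet n fun k => y (k + 1)).toMultilinearMap.map_sum_finset
      (fun i t => (∏ s ∈ Ico (t + 1) (l i.succ), (y 0 + a (s + 1))) • facPow a t)
      fun i => Ico (l i.castSucc) (l i.succ)
  rw [h1, newtonDet_cons_X_sub_C_mul, h2, mul_sum]
  refine sum_congr rfl fun ζ _ => ?_
  have h3 := (newtonDet n fun k => y (k + 1)).toMultilinearMap.map_smul_univ
    (fun i => ∏ s ∈ Ico (ζ i + 1) (l i.succ), (y 0 + a (s + 1))) fun i => facPow a (ζ i)
  simp only [AlternatingMap.coe_multilinearMap] at h3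
  rw [h3, facPow, eval_prod, smul_eq_mul]
  simp only [eval_add, eval_X, eval_C]
  ring

end Branching

/-! ### Branching of factorial Schur functions -/

section Tableaux

theorem rowLen_eq_of_mem_iff {μ : YoungDiagram} {r k : ℕ} (h : ∀ j, (r, j) ∈ μ ↔ j < k) :
    μ.rowLen r = k := by
  refine eq_of_forall_lt_iff fun j => ?_
  rw [← YoungDiagram.mem_iff_lt_rowLen, h]

theorem youngDiagram_ext {μ ν : YoungDiagram} (h : ∀ r, μ.rowLen r = ν.rowLen r) : μ = ν := by
  refine SetLike.ext fun c => ?_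
  obtain ⟨i, j⟩ := c
  rw [YoungDiagram.mem_iff_lt_rowLen, YoungDiagram.mem_iff_lt_rowLen, h]

theorem exists_youngDiagram_rowLen {p : ℕ → ℕ} (hp : Antitone p) {n : ℕ} (hn : p n = 0) :
    ∃ ν : YoungDiagram, ∀ r, ν.rowLen r = p r := by
  refine ⟨⟨(range n ×ˢ range (p 0)).filter fun c => c.2 < p c.1, ?_⟩, fun r => ?_⟩
  · rintro ⟨i, j⟩ ⟨i', j'⟩ ⟨hi, hj⟩ h
    simp only [coe_filter, mem_product, mem_range, Set.mem_ofPred_eq] at h hi hj ⊢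
    have := hp hi
    omega
  · refine rowLen_eq_of_mem_iff fun j => ?_
    change (r, j) ∈ (range n ×ˢ range (p 0)).filter (fun c => c.2 < p c.1) ↔ _
    simp only [mem_filter, mem_product, mem_range]
    refine ⟨fun h => h.2, fun h => ⟨⟨?_, h.trans_le (hp (Nat.zero_le r))⟩, h⟩⟩
    by_contra hr
    have := hp (not_lt.1 hr)
    omega

/-- The diagrams `ν` with at most `n` rows for which `μ / ν` is a horizontal strip. -/
def horizontalStrips (n : ℕ) (μ : YoungDiagram) : Set YoungDiagram :=
  {ν | (∀ r, μ.rowLen (r + 1) ≤ ν.rowLen r ∧ ν.rowLen r ≤ μ.rowLen r) ∧ ν.rowLen n = 0}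

theorem le_of_mem_horizontalStrips {n : ℕ} {μ ν : YoungDiagram}
    (h : ν ∈ horizontalStrips n μ) : ν ≤ μ := by
  rintro ⟨i, j⟩ hc
  rw [YoungDiagram.mem_iff_lt_rowLen] at hc ⊢
  exact hc.trans_le (h.1 i).2

theorem horizontalStrips_finite (n : ℕ) (μ : YoungDiagram) : (horizontalStrips n μ).Finite := by
  refine Set.Finite.of_finite_image (f := YoungDiagram.cells) ?_ ?_
  · refine μ.cells.powerset.finite_toSet.subset ?_
    rintro _ ⟨ν, hν, rfl⟩
    rw [mem_coe, mem_powerset]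
    exact YoungDiagram.cells_subset_iff.2 (le_of_mem_horizontalStrips hν)
  · intro ν _ ν' _ h
    exact YoungDiagram.ext h

/-- The shape formed by the entries `≤ n` of a semistandard tableau. -/
def subShape {μ : YoungDiagram} (T : SemistandardYoungTableau μ) (n : ℕ) : YoungDiagram where
  cells := μ.cells.filter fun c => T c.1 c.2 ≤ n
  isLowerSet := by
    rintro ⟨i, j⟩ ⟨i', j'⟩ ⟨hi, hj⟩ h
    simp only [coe_filter, YoungDiagram.mem_cells, Set.mem_ofPred_eq] at h hi hj ⊢
    have h1 : (i', j) ∈ μ := μ.up_left_mem hi le_rfl h.1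
    exact ⟨μ.up_left_mem hi hj h.1,
      (T.row_weak_of_le hj h1).trans ((T.col_weak hi h.1).trans h.2)⟩

theorem mem_subShape {μ : YoungDiagram} {T : SemistandardYoungTableau μ} {n i j : ℕ} :
    (i, j) ∈ subShape T n ↔ (i, j) ∈ μ ∧ T i j ≤ n := by
  rw [← YoungDiagram.mem_cells, subShape, mem_filter, YoungDiagram.mem_cells]

theorem succ_le_of_mem_boundedSSYT {n : ℕ} {μ : YoungDiagram} {T : SemistandardYoungTableau μ}
    (hT : T ∈ boundedSSYT n μ) {i j : ℕ} (h : (i, j) ∈ μ) : i + 1 ≤ T i j := by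
  induction i with
  | zero => exact (hT (0, j) h).1
  | succ i ih =>
    have h1 := ih (μ.up_left_mem i.le_succ le_rfl h)
    have h2 := T.col_strict (show i < i + 1 by omega) h
    omega

theorem subShape_mem_horizontalStrips {n : ℕ} {μ : YoungDiagram}
    {T : SemistandardYoungTableau μ} (hT : T ∈ boundedSSYT (n + 1) μ) :
    subShape T n ∈ horizontalStrips n μ := by
  refine ⟨fun r => ⟨?_, ?_⟩, ?_⟩
  · refine le_of_forall_lt fun j hj => ?_
    rw [← YoungDiagram.mem_iff_lt_rowLen] at hj ⊢
    refine mem_subShape.2 ⟨μ.up_left_mem r.le_succ le_rfl hj, ?_⟩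
    have h1 := T.col_strict (show r < r + 1 by omega) hj
    have h2 : T (r + 1) j ≤ n + 1 := (hT (r + 1, j) hj).2
    omega
  · refine le_of_forall_lt fun j hj => ?_
    rw [← YoungDiagram.mem_iff_lt_rowLen] at hj ⊢
    exact (mem_subShape.1 hj).1
  · refine rowLen_eq_of_mem_iff fun j => ⟨fun h => ?_, fun h => absurd h (Nat.not_lt_zero j)⟩
    obtain ⟨h1, h2⟩ := mem_subShape.1 h
    have := succ_le_of_mem_boundedSSYT hT h1
    omega

/-- The restriction of a semistandard tableau to a smaller shape. -/
def restrictTableau {μ ν : YoungDiagram} (T : SemistandardYoungTableau μ) (h : ν ≤ μ) :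
    SemistandardYoungTableau ν where
  entry i j := if (i, j) ∈ ν then T i j else 0
  row_weak' {i j1 j2} hj hm := by
    rw [if_pos hm, if_pos (ν.up_left_mem le_rfl hj.le hm)]
    exact T.row_weak hj (h hm)
  col_strict' {i1 i2 j} hi hm := by
    rw [if_pos hm, if_pos (ν.up_left_mem hi.le le_rfl hm)]
    exact T.col_strict hi (h hm)
  zeros' hm := if_neg hm

theorem restrictTableau_apply {μ ν : YoungDiagram} (T : SemistandardYoungTableau μ) (h : ν ≤ μ)
    (i j : ℕ) : restrictTableau T h i j = if (i, j) ∈ ν then T i j else 0 := rfl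

/-- The extension of a semistandard tableau by a horizontal strip filled with `n + 1`. -/
def extendTableau {n : ℕ} {μ ν : YoungDiagram} (T : SemistandardYoungTableau ν)
    (hT : T ∈ boundedSSYT n ν) (h : ν ∈ horizontalStrips n μ) : SemistandardYoungTableau μ where
  entry i j := if (i, j) ∈ ν then T i j else if (i, j) ∈ μ then n + 1 else 0
  row_weak' {i j1 j2} hj hm := by
    have hm1 := μ.up_left_mem le_rfl hj.le hm
    by_cases h2 : (i, j2) ∈ ν
    · rw [if_pos h2, if_pos (ν.up_left_mem le_rfl hj.le h2)]
      exact T.row_weak hj h2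
    · rw [if_neg h2, if_pos hm]
      split_ifs with h1
      · exact (hT (i, j1) h1).2.trans n.le_succ
      · exact le_rfl
  col_strict' {i1 i2 j} hi hm := by
    -- In a horizontal strip, a box with another box of `μ` below it already belongs to `ν`.
    have h1 : (i1, j) ∈ ν := by
      have h3 : (i1 + 1, j) ∈ μ := μ.up_left_mem hi le_rfl hm
      rw [YoungDiagram.mem_iff_lt_rowLen] at h3 ⊢
      exact h3.trans_le (h.1 i1).1
    rw [if_pos h1]
    by_cases h2 : (i2, j) ∈ ν
    · rw [if_pos h2]
      exact T.col_strict hi h2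
    · rw [if_neg h2, if_pos hm]
      exact Nat.lt_succ_of_le (hT (i1, j) h1).2
  zeros' {i j} hm := by
    rw [if_neg fun h1 => hm (le_of_mem_horizontalStrips h h1), if_neg hm]

theorem extendTableau_apply {n : ℕ} {μ ν : YoungDiagram} (T : SemistandardYoungTableau ν)
    (hT : T ∈ boundedSSYT n ν) (h : ν ∈ horizontalStrips n μ) (i j : ℕ) :
    extendTableau T hT h i j = if (i, j) ∈ ν then T i j else if (i, j) ∈ μ then n + 1 else 0 :=
  rfl

variable {K : Type*} [Field K]

open Classical in
-- Group the tableaux by the shape of their entries ≤ n; the entries n + 1 fill the complementary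
-- horizontal strip.
theorem factorialSchur_succ (n : ℕ) (μ : YoungDiagram) (x a : ℕ → K) :
    factorialSchur (n + 1) μ x a = ∑ ν ∈ (horizontalStrips_finite n μ).toFinset,
      factorialSchur n ν x a *
        ∏ c ∈ μ.cells \ ν.cells, (x (n + 1) + a (n + 1 + c.2 - c.1)) := by
  rw [factorialSchur, ← sum_fiberwise_of_maps_to (t := (horizontalStrips_finite n μ).toFinset)
    (g := fun T => subShape T n)]
  · refine sum_congr rfl fun ν hν => ?_
    rw [Set.Finite.mem_toFinset] at hν
    have hle := le_of_mem_horizontalStrips hν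
    rw [factorialSchur, sum_mul]
    refine sum_bij' (fun T _ => restrictTableau T hle)
      (fun T hT => extendTableau T ((Set.Finite.mem_toFinset _).1 hT) hν) ?_ ?_ ?_ ?_ ?_
    · intro T hT
      simp only [mem_filter, Set.Finite.mem_toFinset] at hT ⊢
      rintro ⟨i, j⟩ hc
      have hc' : (i, j) ∈ ν := hc
      have h2 := hc'
      rw [← hT.2, mem_subShape] at h2
      simp only [restrictTableau_apply, if_pos hc']
      exact ⟨(hT.1 (i, j) h2.1).1, h2.2⟩
    · intro T hT
      simp only [mem_filter, Set.Finite.mem_toFinset] at hT ⊢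
      refine ⟨?_, ?_⟩
      · rintro ⟨i, j⟩ hc
        have hc' : (i, j) ∈ μ := hc
        simp only [extendTableau_apply, if_pos hc']
        split_ifs with h
        · have := hT (i, j) h
          exact ⟨this.1, this.2.trans n.le_succ⟩
        · exact ⟨Nat.succ_pos n, le_rfl⟩
      · refine SetLike.ext fun c => ?_
        obtain ⟨i, j⟩ := c
        rw [mem_subShape, extendTableau_apply]
        by_cases h : (i, j) ∈ ν
        · have := hT (i, j) h
          simp only [h, if_true, iff_true]
          exact ⟨hle h, this.2⟩
        · simp only [h, if_false, iff_false]
          rintro ⟨h1, h2⟩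
          rw [if_pos h1] at h2
          omega
    · intro T hT
      simp only [mem_filter, Set.Finite.mem_toFinset] at hT
      ext i j
      rw [extendTableau_apply, restrictTableau_apply]
      split_ifs with h1 h2
      · rfl
      · rw [← hT.2, mem_subShape] at h1
        have := (hT.1 (i, j) h2).2
        have : ¬ T i j ≤ n := fun h => h1 ⟨h2, h⟩
        simp only at *
        omega
      · exact (T.zeros h2).symm
    · intro T hT
      ext i j
      rw [restrictTableau_apply, extendTableau_apply]
      split_ifs with h1
      · rfl
      · exact (T.zeros h1).symm
    · intro T hT
      simp only [mem_filter, Set.Finite.mem_toFinset] at hT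
      rw [← prod_sdiff (YoungDiagram.cells_subset_iff.2 hle), mul_comm]
      congr 1
      · refine prod_congr rfl fun c hc => ?_
        have hc' : (c.1, c.2) ∈ ν := hc
        rw [restrictTableau_apply, if_pos hc']
      · refine prod_congr rfl fun c hc => ?_
        rw [mem_sdiff] at hc
        have h1 := (hT.1 c hc.1).2
        have h2 : ¬ T c.1 c.2 ≤ n := fun h => hc.2 (by
          rw [← hT.2]
          exact mem_subShape.2 ⟨hc.1, h⟩)
        rw [show T c.1 c.2 = n + 1 by omega]
  · intro T hT
    rw [Set.Finite.mem_toFinset] at hT ⊢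
    exact subShape_mem_horizontalStrips hT

theorem factorialSchur_zero {μ : YoungDiagram} (hμ : μ.rowLen 0 = 0) (x a : ℕ → K) :
    factorialSchur 0 μ x a = 1 := by
  have hc : μ.cells = ∅ := by
    rw [eq_empty_iff_forall_notMem]
    rintro ⟨i, j⟩ h
    have h1 := YoungDiagram.mem_iff_lt_rowLen.1 ((YoungDiagram.mem_cells _).1 h)
    have h2 := μ.rowLen_anti 0 i (Nat.zero_le i)
    omega
  have hT : (boundedSSYT_finite 0 μ).toFinset = {SemistandardYoungTableau.highestWeight μ} := by
    rw [eq_singleton_iff_unique_mem]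
    refine ⟨?_, fun T _ => ?_⟩
    · rw [Set.Finite.mem_toFinset]
      intro c h
      rw [hc] at h
      exact absurd h (notMem_empty c)
    · ext i j
      have h : (i, j) ∉ μ := by
        rw [← YoungDiagram.mem_cells, hc]
        exact notMem_empty _
      rw [T.zeros h, SemistandardYoungTableau.zeros _ h]
  rw [factorialSchur, hT, sum_singleton, hc, prod_empty]

/-- Row n of the strip is all of row n of `μ`. In row r = n - 1 - i, column c carries a_{c+i+2}, so
the substitution s = c + i + 1 gives the factors of `newtonDet_facPow_succ`. -/
theorem prod_skew_eq_prod_rows {n : ℕ} {μ ν : YoungDiagram} (hμ : μ.rowLen (n + 1) = 0)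
    (hν : ν.rowLen n = 0) (x : K) (a : ℕ → K) :
    ∏ c ∈ μ.cells \ ν.cells, (x + a (n + 1 + c.2 - c.1)) =
      (∏ s ∈ range (μ.rowLen n), (x + a (s + 1))) *
        ∏ i : Fin n, ∏ s ∈ Ico (ν.rowLen (n - 1 - i) + i + 1) (μ.rowLen (n - 1 - i) + (i + 1)),
          (x + a (s + 1)) := by
  rw [prod_finset_product (μ.cells \ ν.cells) (range (n + 1))
    (fun r => Ico (ν.rowLen r) (μ.rowLen r)), prod_range_succ, mul_comm]
  · congr 1
    · rw [hν, ← range_eq_Ico]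
      refine prod_congr rfl fun s _ => ?_
      congr 2
      omega
    · rw [← prod_range_reflect, Fin.prod_univ_eq_prod_range (fun i =>
        ∏ s ∈ Ico (ν.rowLen (n - 1 - i) + i + 1) (μ.rowLen (n - 1 - i) + (i + 1)),
          (x + a (s + 1))) n]
      refine prod_congr rfl fun i hi => ?_
      rw [mem_range] at hi
      rw [add_assoc, ← prod_Ico_add']
      refine prod_congr rfl fun s _ => ?_
      congr 2
      omega
  · rintro ⟨i, j⟩
    rw [mem_sdiff, YoungDiagram.mem_cells, YoungDiagram.mem_cells, YoungDiagram.mem_iff_lt_rowLen,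
      YoungDiagram.mem_iff_lt_rowLen, mem_range, mem_Ico, not_lt, and_comm (a := j < _)]
    refine ⟨fun h => ⟨?_, h⟩, fun h => h.2⟩
    by_contra hi
    have := μ.rowLen_anti (n + 1) i (not_lt.1 hi)
    omega

/-- Both sides obey the same branching rule. The shift by `i` in the exponents turns μ_{r+1} ≤ ν_r ≤
μ_r into the half-open interlacing intervals; rows are reversed so that exponents increase. -/
theorem factorialSchur_eq_newtonDet (n : ℕ) {μ : YoungDiagram} (hμ : μ.rowLen n = 0)
    (x a : ℕ → K) :
    factorialSchur n μ x a = newtonDet n (fun k => x (n - k))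
      (fun i : Fin n => facPow a (μ.rowLen (n - 1 - i) + i)) := by
  induction n generalizing μ with
  | zero => rw [factorialSchur_zero hμ, newtonDet_zero]
  | succ n ih =>
    rw [factorialSchur_succ, newtonDet_facPow_succ a n (fun k => x (n + 1 - k))
      (fun i : Fin (n + 1) => μ.rowLen (n + 1 - 1 - i) + i)]
    · refine sum_nbij (fun ν (i : Fin n) => ν.rowLen (n - 1 - i) + i) ?_ ?_ ?_ ?_
      · intro ν hν
        rw [Set.Finite.mem_toFinset] at hν
        refine Fintype.mem_piFinset.2 fun i => ?_
        have h := hν.1 (n - 1 - i)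
        have h1 : n + 1 - 1 - (i : ℕ) = n - 1 - i + 1 := by omega
        have h2 : n + 1 - 1 - ((i : ℕ) + 1) = n - 1 - i := by omega
        simp only [mem_Ico, Fin.val_castSucc, Fin.val_succ, h1, h2]
        omega
      · intro ν hν ν' hν' h
        rw [mem_coe, Set.Finite.mem_toFinset] at hν hν'
        refine youngDiagram_ext fun r => ?_
        by_cases hr : r < n
        · have := congrFun h ⟨n - 1 - r, by omega⟩
          simp only [show n - 1 - (n - 1 - r) = r by omega] at this
          omega
        · have h1 := ν.rowLen_anti n r (not_lt.1 hr)
          have h2 := ν'.rowLen_anti n r (not_lt.1 hr)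
          have h3 := hν.2
          have h4 := hν'.2
          omega
      · intro ζ hζ
        rw [mem_coe, Fintype.mem_piFinset] at hζ
        -- Row lengths of the strip recovered from `ζ`: undo the shift and the reversal of rows.
        let p : ℕ → ℕ := fun r =>
          if h : r < n then ζ ⟨n - 1 - r, by omega⟩ - (n - 1 - r) else 0
        have hp : ∀ r, μ.rowLen (r + 1) ≤ p r ∧ p r ≤ μ.rowLen r := by
          intro r
          by_cases hr : r < n
          · have h := hζ ⟨n - 1 - r, by omega⟩
            have h1 : n + 1 - 1 - (n - 1 - r) = r + 1 := by omega
            have h2 : n + 1 - 1 - (n - 1 - r + 1) = r := by omega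
            simp only [mem_Ico, Fin.val_castSucc, Fin.val_succ, h1, h2] at h
            simp only [p, dif_pos hr]
            omega
          · have := μ.rowLen_anti (n + 1) (r + 1) (by omega)
            simp only [p, dif_neg hr]
            omega
        obtain ⟨ν, hν⟩ := exists_youngDiagram_rowLen (p := p) (n := n)
          (antitone_nat_of_succ_le fun r => (hp (r + 1)).2.trans (hp r).1) (by simp [p])
        refine ⟨ν, ?_, funext fun i => ?_⟩
        · rw [mem_coe, Set.Finite.mem_toFinset]
          refine ⟨fun r => ?_, ?_⟩
          · rw [hν]
            exact hp r
          · rw [hν]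
            simp [p]
        · have h := hζ i
          have hi := i.2
          have h3 : n - 1 - (n - 1 - (i : ℕ)) = i := by omega
          simp only [mem_Ico, Fin.val_castSucc] at h
          simp only [hν, p, dif_pos (show n - 1 - (i : ℕ) < n by omega), h3, Fin.eta]
          omega
      · intro ν hν
        rw [Set.Finite.mem_toFinset] at hν
        rw [ih hν.2, prod_skew_eq_prod_rows hμ hν.2]
        have h : ∀ i : Fin n, n - ((i : ℕ) + 1) = n - 1 - i := fun i => by omega
        simp only [Nat.add_sub_add_right, Nat.sub_zero, Fin.val_zero, Fin.val_succ,
          Nat.add_sub_cancel, Nat.add_zero, h]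
    · intro i
      have := μ.rowLen_anti (n + 1 - 1 - (i + 1)) (n + 1 - 1 - i) (by omega)
      simp only [Fin.val_castSucc, Fin.val_succ]
      omega

end Tableaux

/-! ### Normalization -/

section Normalization

open Polynomial

variable {K : Type*} [Field K]

theorem icePoly_eq_smul_facPow (a : ℕ → K) (k : ℕ) (ha : ∀ t ∈ range k, a (t + 1) ≠ 0) :
    icePoly a k = (∏ t ∈ range k, -(a (t + 1))⁻¹) • facPow a k := by
  induction k with
  | zero => simp [icePoly, facPow]
  | succ k ih =>
    have h0 := ha k (self_mem_range_succ k)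
    have h1 : (C (a (k + 1))⁻¹ * C (a (k + 1)) : K[X]) = 1 := by
      rw [← C_mul, inv_mul_cancel₀ h0, C_1]
    rw [icePoly, ih fun t ht => ha t (mem_range.2 ((mem_range.1 ht).trans k.lt_succ_self)),
      facPow_succ, prod_range_succ, smul_eq_C_mul, smul_eq_C_mul, C_mul, C_neg]
    linear_combination (-C (∏ t ∈ range k, -(a (t + 1))⁻¹) * facPow a k) * (-h1)

/-- Both sides are the product of a_j over the boxes of `ν`, j being the column, taken by columns
and by rows. -/
theorem multiPow_conj (n m : ℕ) (ν : ℕ → ℕ) (hν : ∀ i ∈ Icc 1 n, ν i ≤ m) (a : ℕ → K) :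
    multiPow m a (conj n ν) = ∏ i ∈ Icc 1 n, ∏ t ∈ range (ν i), a (t + 1) := by
  have h : ∀ j, a j ^ conj n ν j = ∏ i ∈ Icc 1 n, if j ≤ ν i then a j else 1 := fun j => by
    rw [prod_ite, prod_const, prod_const_one, mul_one, conj]
  rw [multiPow, prod_congr rfl fun j _ => h j, prod_comm]
  refine prod_congr rfl fun i hi => ?_
  rw [← prod_filter, range_eq_Ico, prod_Ico_add' (fun t => a t)]
  refine prod_congr ?_ fun _ _ => rfl
  ext j
  have := hν i hi
  simp only [mem_filter, mem_Icc, mem_Ico]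
  omega

theorem prod_neg_inv_eq (n m : ℕ) (ν : ℕ → ℕ) (hν : ∀ i ∈ Icc 1 n, ν i ≤ m) (a : ℕ → K) :
    ∏ i ∈ Icc 1 n, ∏ t ∈ range (ν i), -(a (t + 1))⁻¹ =
      (-1) ^ weight n ν / multiPow m a (conj n ν) := by
  rw [multiPow_conj n m ν hν, weight, ← prod_pow_eq_pow_sum, ← prod_div_distrib]
  refine prod_congr rfl fun i _ => ?_
  rw [prod_neg, card_range, prod_inv_distrib, div_eq_mul_inv]

end Normalization

end SixVertex

open SixVertex in
theorem mainTheorem7 {K : Type*} [Field K] (n : ℕ) (μ : YoungDiagram) (hμ : μ.colLen 0 ≤ n)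
    (x a : ℕ → K) (ha : ∀ j ∈ Finset.Icc 1 (SixVertex.lam n μ 1), a j ≠ 0) :
    SixVertex.partitionFunction n (SixVertex.lam n μ) (SixVertex.boltzmann x a) =
      SixVertex.multiPow n x (SixVertex.rho n) /
          SixVertex.multiPow (SixVertex.lam n μ 1) a (SixVertex.conj n (SixVertex.kap n μ)) *
        (-1) ^ SixVertex.weight n (SixVertex.kap n μ) * SixVertex.factorialSchur n μ x a := by
  have hrow : μ.rowLen n = 0 := by
    refine rowLen_eq_of_mem_iff fun j => ⟨fun h => ?_, fun h => absurd h (Nat.not_lt_zero j)⟩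
    have h1 := YoungDiagram.mem_iff_lt_colLen.1 (μ.up_left_mem le_rfl (Nat.zero_le j) h)
    omega
  have hm : lam n μ 1 = μ.rowLen 0 + n := rfl
  have hlt : ∀ i : Fin n, μ.rowLen (n - 1 - i) + i < lam n μ 1 := fun i => by
    have := μ.rowLen_anti 0 (n - 1 - i) (Nat.zero_le _)
    omega
  -- The value is κ_{n-i} = λ_{n-i} - 1, the zero-based column of an outgoing bottom edge, listed
  -- from left to right.
  let l : Fin n → Fin (lam n μ 1) := fun i => ⟨μ.rowLen (n - 1 - i) + i, hlt i⟩
  have hl : StrictMono l := fun i i' hii' => by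
    have h : (i : ℕ) < i' := hii'
    have := μ.rowLen_anti (n - 1 - i') (n - 1 - i) (by omega)
    change μ.rowLen (n - 1 - i) + i < μ.rowLen (n - 1 - i') + i'
    omega
  let bot : Fin (lam n μ 1) → Bool := fun j => decide (∃ i, l i = j)
  have hbot' : ∀ j, bot j = true ↔ ∃ i, l i = j := fun j => decide_eq_true_iff
  have hbot : ∀ j, bot j = true ↔ ∃ k ∈ Finset.Icc 1 n, lam n μ k = (j : ℕ) + 1 := fun j => by
    rw [hbot']
    symm
    constructor
    · rintro ⟨k, hk, hkj⟩
      rw [Finset.mem_Icc] at hk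
      refine ⟨⟨n - k, by omega⟩, Fin.ext ?_⟩
      change μ.rowLen (n - 1 - (n - k)) + (n - k) = j
      rw [lam] at hkj
      rw [show n - 1 - (n - k) = k - 1 by omega]
      omega
    · rintro ⟨i, rfl⟩
      refine ⟨n - i, Finset.mem_Icc.2 (by omega), ?_⟩
      change μ.rowLen (n - i - 1) + (n + 1 - (n - i)) = μ.rowLen (n - 1 - i) + i + 1
      rw [show n - i - 1 = n - 1 - i by omega]
      omega
  have hkap : ∀ i ∈ Finset.Icc 1 n, kap n μ i ≤ lam n μ 1 := fun i _ => by
    have := μ.rowLen_anti 0 (i - 1) (Nat.zero_le _)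
    rw [kap, rho, hm]
    omega
  have hpoly : ∀ i, icePoly a (l i) =
      (∏ t ∈ Finset.range (kap n μ (n - i)), -(a (t + 1))⁻¹) •
        facPow a (μ.rowLen (n - 1 - i) + i) := fun i => by
    have h : kap n μ (n - i) = μ.rowLen (n - 1 - i) + i := by
      rw [kap, rho, show n - i - 1 = n - 1 - (i : ℕ) by omega]
      omega
    rw [h]
    refine icePoly_eq_smul_facPow a _ fun t ht => ha _ (Finset.mem_Icc.2 ?_)
    have h1 := hlt i
    rw [Finset.mem_range] at ht
    omega
  have hsmul := (newtonDet n fun k => x (n - k)).toMultilinearMap.map_smul_univ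
    (fun i : Fin n => ∏ t ∈ Finset.range (kap n μ (n - i)), -(a (t + 1))⁻¹)
    fun i => facPow a (μ.rowLen (n - 1 - i) + i)
  simp only [AlternatingMap.coe_multilinearMap] at hsmul
  rw [partitionFunction_eq_iceSum n (lam n μ) _ bot hbot, iceSum_boltzmann,
    wedge_eq_ιMulti (icePoly a) bot l hl hbot', iceForm_ιMulti, if_pos rfl, funext hpoly, hsmul,
    ← factorialSchur_eq_newtonDet n hrow, smul_eq_mul,
    ← prod_Icc_eq_prod_fin_rev n fun k => ∏ t ∈ Finset.range (kap n μ k), -(a (t + 1))⁻¹,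
    prod_neg_inv_eq n _ _ hkap]
  ring
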